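/- Let $(b_n)_{n\ge 0}$ be the Baum–Sweet sequence: $b_0=1$, and for $n\ge 1$, $b_n=0$ if the binary expansion of $n$ contains a (maximal) block of consecutive $0$'s of odd length, and $b_n=1$ otherwise. Put $b''_0=0$ and $b''_n=b_{n-1}$ for $n\ge 1$, and regard $(b''_n)$ as a sequence in the field $\mathbb{F}_2$. Let $(q_n)_{n\ge 0}$ be the formal inverse of $(b''_n)$, i.e. the sequence in $\mathbb{F}_2$ with $q_0=0$ for which the power series $D=\sum_{n\ge 0} b''_nX^n$ and $Q=\sum_{n\ge 0} q_nX^n$ in $\mathbb{F}_2[[X]]$ satisfy $D(Q(X))=Q(D(X))=X$. Let $(v_n)_{n\ge 0}$ be the characteristic sequence of $0$'s in $(q_n)$, i.e. the (strictly) increasing sequence of natural numbers with $\{v_n : n\ge 0\}=\{m\ge 0 : q_m=0\}$. For $k\ge 2$, a sequence $(u_n)_{n\ge 0}$ with values in a $\mathbb{Z}$-module $M$ is called $k$-regular if there are finitely many sequences $(s^{(1)}_n)_{n\ge 0},\dots,(s^{(m)}_n)_{n\ge 0}$ with values in $M$ such that each sequence $(u_{k^in+j})_{n\ge 0}$ with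 $i\ge 0$ and $0\le j<k^i$ is a linear combination of $s^{(1)},\dots,s^{(m)}$ with coefficients in $\mathbb{Z}$. **Theorem.** The sequence of integers $(v_n)_{n\ge 0}$ is not $k$-regular for any $k\ge 2$. -/

import Mathlib

/-- The binary expansion of `n` contains a (maximal) block of `0`'s of odd length.
The expansion is the list `Nat.digits 2 n`, least significant digit first, without leading
zeros (it is empty for `n = 0`). -/
def HasOddZeroBlock (n : ℕ) : Prop :=
  ∃ (l₁ l₂ : List ℕ) (m : ℕ), Nat.digits 2 n = l₁ ++ List.replicate m 0 ++ l₂ ∧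
    l₁.getLast? ≠ some 0 ∧ l₂.head? ≠ some 0 ∧ Odd m

open Classical in
/-- The Baum–Sweet sequence `b`, with values in the field with two elements (so `b 0 = 1`). -/
noncomputable def baumSweet (n : ℕ) : ZMod 2 :=
  if HasOddZeroBlock n then 0 else 1

/-- The shifted Baum–Sweet sequence `b''`: `b'' 0 = 0` and `b'' (n + 1) = b n`. -/
noncomputable def baumSweetShift : ℕ → ZMod 2
  | 0 => 0
  | n + 1 => baumSweet n

/-- `v` is the formal inverse of `u`: the power series `U = ∑ u n X ^ n` and `V = ∑ v n X ^ n`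
have zero constant term and satisfy `U(V(X)) = V(U(X)) = X`. -/
def IsFormalInverse {F : Type*} [Field F] (u v : ℕ → F) : Prop :=
  u 0 = 0 ∧ v 0 = 0 ∧
    PowerSeries.subst (PowerSeries.mk v) (PowerSeries.mk u) = (PowerSeries.X : PowerSeries F) ∧
    PowerSeries.subst (PowerSeries.mk u) (PowerSeries.mk v) = (PowerSeries.X : PowerSeries F)

/-- `v` is the characteristic sequence of `a` in the sequence `q`: the increasing sequence of all
indices at which `q` takes the value `a`. -/
def IsCharacteristicSequence {α : Type*} (a : α) (q : ℕ → α) (v : ℕ → ℕ) : Prop :=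
  StrictMono v ∧ Set.range v = {m : ℕ | q m = a}

/-- The `k`-kernel of a sequence: all subsequences `n ↦ u (k ^ i * n + j)` with `0 ≤ j < k ^ i`. -/
def kKernel {M : Type*} (k : ℕ) (u : ℕ → M) : Set (ℕ → M) :=
  {w | ∃ i j : ℕ, j < k ^ i ∧ w = fun n => u (k ^ i * n + j)}

/-- A sequence with values in a `ℤ`-module `M` is `k`-regular if there are finitely many sequences
with values in `M` such that every element of the `k`-kernel is a `ℤ`-linear combination of
them. -/
def IsKRegular {M : Type*} [AddCommGroup M] (k : ℕ) (u : ℕ → M) : Prop :=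
  ∃ (m : ℕ) (s : Fin m → ℕ → M), ∀ w ∈ kKernel k u,
    ∃ a : Fin m → ℤ, ∀ n, w n = ∑ r, a r • s r n

/-! Over `𝔽₂` the Baum–Sweet series satisfies `B = X B² + B⁴`, so `D = X B` satisfies `D³ = X³(1 +
D)`. Substituting `Q = X P` gives `(1 + X) P³ = 1`, hence `P = (1 + X) P(X⁴)`: `P` is the indicator
of sums of distinct powers of 4.

Thus `q` has a long run of zeros ending at `4 ^ M`, followed by exactly two ones. Counting zeros,
`v` jumps by 3 at `4 ^ M - 2 ^ M` and by 1 on `[4 ^ M / 2, 4 ^ M - 2 ^ M)`. If `v` were `k`-regular,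
its differences `c` mod 3 would have a finite `k`-kernel. Pigeonhole on the kernel then carries a
jump of 3 into a stretch of jumps of 1: by an explicit shift if `k` is a power of 2
(`infinite_kKernel_two_pow`), and otherwise by pumping and the irrationality of `log k / log 4`
(`infinite_kKernel_of_ne_two_pow`). -/

/-! ### Recurrences for the Baum–Sweet sequence. -/

theorem hasOddZeroBlock_two_mul_add_one (n : ℕ) :
    HasOddZeroBlock (2 * n + 1) ↔ HasOddZeroBlock n := by
  have hd : Nat.digits 2 (2 * n + 1) = 1 :: Nat.digits 2 n := by
    rw [add_comm]
    exact Nat.digits_add 2 (by norm_num) 1 n (by norm_num) (by norm_num)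
  unfold HasOddZeroBlock
  rw [hd]
  constructor
  · rintro ⟨l₁, l₂, m, h, h₁, h₂, hm⟩
    rcases l₁ with _ | ⟨a, l₁⟩
    · obtain ⟨m, rfl⟩ := Nat.exists_eq_succ_of_ne_zero hm.pos.ne'
      simp [List.replicate_succ] at h
    · simp only [List.cons_append, List.cons.injEq] at h
      refine ⟨l₁, l₂, m, h.2, ?_, h₂, hm⟩
      rcases l₁ with _ | ⟨b, l₁⟩
      · simp
      · simpa using h₁
  · rintro ⟨l₁, l₂, m, h, h₁, h₂, hm⟩
    refine ⟨1 :: l₁, l₂, m, by simp [h], ?_, h₂, hm⟩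
    rcases l₁ with _ | ⟨b, l₁⟩
    · simp
    · simpa using h₁

theorem hasOddZeroBlock_four_mul (n : ℕ) :
    HasOddZeroBlock (4 * n) ↔ HasOddZeroBlock n := by
  rcases Nat.eq_zero_or_pos n with rfl | hn
  · simp
  have hd : Nat.digits 2 (4 * n) = 0 :: 0 :: Nat.digits 2 n := by
    rw [show 4 * n = 2 * (2 * n) by ring, Nat.digits_def' (by norm_num) (by omega),
      Nat.mul_div_cancel_left _ (by norm_num : 0 < 2), Nat.mul_mod_right,
      Nat.digits_def' (b := 2) (n := 2 * n) (by norm_num) (by omega),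
      Nat.mul_div_cancel_left _ (by norm_num : 0 < 2), Nat.mul_mod_right]
  unfold HasOddZeroBlock
  rw [hd]
  constructor
  · rintro ⟨l₁, l₂, m, h, h₁, h₂, hm⟩
    match l₁ with
    | [] =>
      match m with
      | 0 => simp at hm
      | 1 =>
        simp only [List.replicate_one, List.nil_append, List.cons_append, List.cons.injEq,
          true_and] at h
        simp [← h] at h₂
      | m + 2 =>
        refine ⟨[], l₂, m, ?_, by simp, h₂, ?_⟩
        · simpa [List.replicate_succ] using h
        · simpa [Nat.odd_add] using hm
    | [a] => simp_all
    | [a, b] =>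
      simp only [List.cons_append, List.cons.injEq] at h
      simp [← h.2.1] at h₁
    | a :: b :: c :: l =>
      refine ⟨c :: l, l₂, m, ?_, ?_, h₂, hm⟩
      · simp at h
        simp [h.2.2]
      · simpa using h₁
  · rintro ⟨l₁, l₂, m, h, h₁, h₂, hm⟩
    rcases l₁ with _ | ⟨b, l₁⟩
    · refine ⟨[], l₂, m + 2, by simp [h, List.replicate_succ], by simp, h₂, ?_⟩
      simpa [Nat.odd_add] using hm
    · refine ⟨0 :: 0 :: b :: l₁, l₂, m, by simp [h], ?_, h₂, hm⟩
      simpa using h₁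

theorem hasOddZeroBlock_four_mul_add_two (n : ℕ) : HasOddZeroBlock (4 * n + 2) := by
  refine ⟨[], 1 :: Nat.digits 2 n, 1, ?_, by simp, by simp, by decide⟩
  have h : Nat.digits 2 (2 * n + 1) = 1 :: Nat.digits 2 n := by
    rw [add_comm]
    exact Nat.digits_add 2 (by norm_num) 1 n (by norm_num) (by norm_num)
  rw [show 4 * n + 2 = 2 * (2 * n + 1) by ring, Nat.digits_def' (by norm_num) (by omega),
      Nat.mul_div_cancel_left _ (by norm_num : 0 < 2), Nat.mul_mod_right, h]
  simp

theorem baumSweet_zero : baumSweet 0 = 1 := by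
  refine if_neg ?_
  rintro ⟨l₁, l₂, m, h, -, -, hm⟩
  rw [Nat.digits_zero, eq_comm, List.append_eq_nil_iff, List.append_eq_nil_iff,
    List.replicate_eq_nil_iff] at h
  simp [h.1.2] at hm

theorem baumSweet_two_mul_add_one (n : ℕ) : baumSweet (2 * n + 1) = baumSweet n := by
  unfold baumSweet
  congr 1
  rw [hasOddZeroBlock_two_mul_add_one]

theorem baumSweet_four_mul (n : ℕ) : baumSweet (4 * n) = baumSweet n := by
  unfold baumSweet
  congr 1
  rw [hasOddZeroBlock_four_mul]

theorem baumSweet_four_mul_add_two (n : ℕ) : baumSweet (4 * n + 2) = 0 := by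
  simp [baumSweet, hasOddZeroBlock_four_mul_add_two]

/-! ### Algebraic equations over `𝔽₂`. -/

namespace PowerSeries

theorem expand_two_eq_sq (f : PowerSeries (ZMod 2)) : expand 2 two_ne_zero f = f ^ 2 := by
  have h := MvPowerSeries.map_frobenius_expand (σ := Unit) (R := ZMod 2) 2 two_ne_zero (f := f)
  rw [ZMod.frobenius_zmod, MvPowerSeries.map_id] at h
  exact h

theorem expand_four_eq_pow (f : PowerSeries (ZMod 2)) : expand 4 four_ne_zero f = f ^ 4 := by
  have h := expand_mul (R := ZMod 2) 2 two_ne_zero 2 two_ne_zero f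
  rw [expand_two_eq_sq, expand_two_eq_sq, ← pow_mul] at h
  exact h

end PowerSeries

open PowerSeries in
theorem mk_baumSweet_eq :
    (mk baumSweet : PowerSeries (ZMod 2)) = X * mk baumSweet ^ 2 + mk baumSweet ^ 4 := by
  rw [← expand_two_eq_sq, ← expand_four_eq_pow]
  ext n
  rcases n with _ | n
  · simp
  · rw [map_add, coeff_succ_X_mul, coeff_expand, coeff_expand, coeff_mk]
    simp only [coeff_mk]
    obtain ⟨m, hm | hm⟩ := Nat.even_or_odd' n
    · rw [if_pos ⟨m, hm⟩, if_neg (by omega), hm, baumSweet_two_mul_add_one]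
      simp
    · rw [if_neg (by omega)]
      obtain ⟨r, hr | hr⟩ := Nat.even_or_odd' m
      · rw [if_neg (by omega), show n + 1 = 4 * r + 2 by omega, baumSweet_four_mul_add_two]
        simp
      · rw [if_pos (by omega), show n + 1 = 4 * (r + 1) by omega, baumSweet_four_mul]
        simp

open PowerSeries in
theorem mk_baumSweetShift_eq :
    (mk baumSweetShift : PowerSeries (ZMod 2)) = X * mk baumSweet := by
  ext n
  rcases n with _ | n
  · simp [baumSweetShift]
  · rw [coeff_succ_X_mul]
    simp [baumSweetShift]

open PowerSeries in
theorem mk_baumSweetShift_cube :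
    (mk baumSweetShift : PowerSeries (ZMod 2)) ^ 3 = X ^ 3 * (1 + mk baumSweetShift) := by
  have h0 : (mk baumSweet : PowerSeries (ZMod 2)) ≠ 0 := fun h => by
    have := congrArg (coeff 0) h
    simp [baumSweet_zero] at this
  have h1 : (1 : PowerSeries (ZMod 2)) = X * mk baumSweet + mk baumSweet ^ 3 := by
    apply mul_left_cancel₀ h0
    linear_combination mk_baumSweet_eq
  have h2 : (2 : PowerSeries (ZMod 2)) = 0 := by
    rw [← map_ofNat (C (R := ZMod 2)) 2, show (OfNat.ofNat 2 : ZMod 2) = 0 from rfl, map_zero]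
  rw [mk_baumSweetShift_eq]
  linear_combination (-X ^ 3) * h1 + (-X ^ 4 * mk baumSweet) * h2

/-! ### The inverse series and sums of distinct powers of 4. -/

/-- The sequence `p` is the characteristic sequence, with values in `ZMod 2`, of the sums of
distinct powers of `4`. -/
structure IsMoserDeBruijn (p : ℕ → ZMod 2) : Prop where
  zero : p 0 = 1
  four_mul (n : ℕ) : p (4 * n) = p n
  four_mul_add_one (n : ℕ) : p (4 * n + 1) = p n
  four_mul_add_two (n : ℕ) : p (4 * n + 2) = 0
  four_mul_add_three (n : ℕ) : p (4 * n + 3) = 0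

open PowerSeries in
theorem IsMoserDeBruijn.of_mk_eq {p : ℕ → ZMod 2} (h0 : p 0 = 1)
    (h : PowerSeries.mk p = (1 + PowerSeries.X) * PowerSeries.mk p ^ 4) : IsMoserDeBruijn p := by
  rw [← expand_four_eq_pow, one_add_mul] at h
  have hs (n : ℕ) : p (n + 1) = (if 4 ∣ n + 1 then p ((n + 1) / 4) else 0)
      + if 4 ∣ n then p (n / 4) else 0 := by
    have := congrArg (coeff (n + 1)) h
    rw [map_add, coeff_succ_X_mul, coeff_expand, coeff_expand] at this
    simpa only [coeff_mk] using this
  refine ⟨h0, fun n => ?_, fun n => ?_, fun n => ?_, fun n => ?_⟩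
  · rcases n with _ | n
    · rfl
    · rw [show 4 * (n + 1) = 4 * n + 3 + 1 by ring, hs, if_pos (by omega), if_neg (by omega),
        add_zero]
      congr 1
      omega
  · rw [hs, if_neg (by omega), if_pos (by omega), zero_add]
    congr 1
    omega
  · rw [show 4 * n + 2 = 4 * n + 1 + 1 by ring, hs, if_neg (by omega), if_neg (by omega), add_zero]
  · rw [show 4 * n + 3 = 4 * n + 2 + 1 by ring, hs, if_neg (by omega), if_neg (by omega), add_zero]

open PowerSeries in
theorem IsFormalInverse.isMoserDeBruijn {q : ℕ → ZMod 2}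
    (hq : IsFormalInverse baumSweetShift q) : IsMoserDeBruijn fun n => q (n + 1) := by
  obtain ⟨-, h0, h, -⟩ := hq
  have hs : HasSubst (mk q : PowerSeries (ZMod 2)) :=
    HasSubst.of_constantCoeff_zero' (by simp [← coeff_zero_eq_constantCoeff_apply, h0])
  have hc := congrArg (substAlgHom (R := ZMod 2) hs) mk_baumSweetShift_cube
  simp only [map_pow, map_mul, map_add, map_one, substAlgHom_X] at hc
  rw [coe_substAlgHom, h] at hc
  set P : PowerSeries (ZMod 2) := mk fun n => q (n + 1) with hP
  have hQ : (mk q : PowerSeries (ZMod 2)) = X * P := by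
    ext n
    rcases n with _ | n
    · simp [h0]
    · rw [coeff_succ_X_mul]
      simp [hP]
  have h1 : (1 + X) * P ^ 3 = 1 := by
    apply mul_left_cancel₀ (pow_ne_zero 3 (X_ne_zero (R := ZMod 2)))
    rw [hQ] at hc
    linear_combination -hc
  refine .of_mk_eq ?_ ?_
  · have hP0 : constantCoeff P = q 1 := by
      rw [← coeff_zero_eq_constantCoeff_apply, hP, coeff_mk]
    have := congrArg constantCoeff h1
    simp only [map_mul, map_add, map_one, map_pow, constantCoeff_X, hP0] at this
    change q 1 = 1
    generalize q 1 = x at this ⊢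
    decide +revert
  · linear_combination (-P) * h1

namespace IsMoserDeBruijn

variable {p : ℕ → ZMod 2}

theorem apply_four_pow (hp : IsMoserDeBruijn p) (M : ℕ) : p (4 ^ M) = 1 := by
  induction M with
  | zero => simpa [hp.zero] using hp.four_mul_add_one 0
  | succ M ih => rw [pow_succ', hp.four_mul, ih]

/-- The leading base-4 digit of such an `m` is 2 or 3. -/
theorem apply_eq_zero_of_le (hp : IsMoserDeBruijn p) (M : ℕ) :
    ∀ m, 4 ^ (M + 1) ≤ 2 * m → m < 4 ^ (M + 1) → p m = 0 := by
  induction M with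
  | zero =>
    intro m h₁ h₂
    obtain rfl | rfl : m = 4 * 0 + 2 ∨ m = 4 * 0 + 3 := by omega
    · exact hp.four_mul_add_two 0
    · exact hp.four_mul_add_three 0
  | succ M ih =>
    intro m h₁ h₂
    rw [pow_succ'] at h₁ h₂
    have hd := ih (m / 4) (by have := pow_succ' 4 M; omega) (by omega)
    obtain h | h | h | h : m = 4 * (m / 4) ∨ m = 4 * (m / 4) + 1 ∨ m = 4 * (m / 4) + 2 ∨
      m = 4 * (m / 4) + 3 := by omega
    · rw [h, hp.four_mul, hd]
    · rw [h, hp.four_mul_add_one, hd]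
    · rw [h, hp.four_mul_add_two]
    · rw [h, hp.four_mul_add_three]

theorem count_four_mul (hp : IsMoserDeBruijn p) (N : ℕ) :
    Nat.count (p · = 0) (4 * N) = 2 * Nat.count (p · = 0) N + 2 * N := by
  induction N with
  | zero => simp
  | succ N ih =>
    rw [show 4 * (N + 1) = 4 * N + 1 + 1 + 1 + 1 by ring]
    simp only [Nat.count_succ, ih]
    rw [show 4 * N + 1 + 1 + 1 = 4 * N + 3 by ring, show 4 * N + 1 + 1 = 4 * N + 2 by ring]
    simp only [hp.four_mul, hp.four_mul_add_one, hp.four_mul_add_two, hp.four_mul_add_three]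
    split_ifs <;> omega

theorem count_four_pow (hp : IsMoserDeBruijn p) (M : ℕ) :
    Nat.count (p · = 0) (4 ^ M) + 2 ^ M = 4 ^ M := by
  induction M with
  | zero => rw [pow_zero, pow_zero, Nat.count_one, hp.zero, if_neg one_ne_zero, zero_add]
  | succ M ih =>
    rw [pow_succ' 4, hp.count_four_mul, pow_succ']
    omega

end IsMoserDeBruijn

/-! ### Jumps of `v`. -/

namespace IsCharacteristicSequence

theorem eq_nth {α : Type*} {a : α} {q : ℕ → α} {v : ℕ → ℕ}
    (hv : IsCharacteristicSequence a q v) : v = Nat.nth (q · = a) := by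
  have hi : {m | q m = a}.Infinite := hv.2 ▸ Set.infinite_range_of_injective hv.1.injective
  exact (hv.1.range_inj (Nat.nth_strictMono hi)).1 (hv.2.trans (Nat.range_nth_of_infinite hi).symm)

theorem apply_count {α : Type*} [DecidableEq α] {a : α} {q : ℕ → α} {v : ℕ → ℕ}
    (hv : IsCharacteristicSequence a q v) {m : ℕ} (hm : q m = a) :
    v (Nat.count (q · = a) m) = m := by
  rw [hv.eq_nth]
  exact Nat.nth_count hm

theorem apply_add_one {α : Type*} {a : α} {q : ℕ → α} {v : ℕ → ℕ}
    (hv : IsCharacteristicSequence a q v) {n : ℕ} (hn : q (v n + 1) = a) :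
    v (n + 1) = v n + 1 := by
  obtain ⟨m, hm⟩ : v n + 1 ∈ Set.range v := hv.2 ▸ hn
  have h₁ : n < m := hv.1.lt_iff_lt.1 (by omega)
  have h₂ := hv.1.monotone (show n + 1 ≤ m from h₁)
  have h₃ := hv.1 (show n < n + 1 by omega)
  omega

variable {q : ℕ → ZMod 2} {v : ℕ → ℕ}

theorem count_four_pow (hp : IsMoserDeBruijn fun n => q (n + 1)) (h0 : q 0 = 0) {M : ℕ}
    (hM : 1 ≤ M) : q (4 ^ M) = 0 ∧ Nat.count (q · = 0) (4 ^ M) = 4 ^ M - 2 ^ M := by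
  obtain ⟨M, rfl⟩ := Nat.exists_eq_add_of_le' hM
  have h4 : 4 ≤ 4 ^ (M + 1) := by simpa using Nat.pow_le_pow_right (n := 4) (by norm_num) hM
  have hq : q (4 ^ (M + 1)) = 0 := by
    have := hp.apply_eq_zero_of_le M (4 ^ (M + 1) - 1) (by omega) (by omega)
    rwa [Nat.sub_add_cancel (by omega)] at this
  -- The index shift costs nothing: the zero gained at index 0 offsets the one at `4 ^ (M + 1)`.
  have h₁ := Nat.count_succ' (q · = 0) (4 ^ (M + 1))
  rw [Nat.count_succ, if_pos hq, if_pos h0] at h₁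
  have h₂ := hp.count_four_pow (M + 1)
  exact ⟨hq, by omega⟩

theorem apply_four_pow_sub_two_pow (hp : IsMoserDeBruijn fun n => q (n + 1)) (h0 : q 0 = 0)
    (hv : IsCharacteristicSequence 0 q v) {M : ℕ} (hM : 1 ≤ M) :
    v (4 ^ M - 2 ^ M) = 4 ^ M := by
  obtain ⟨hq, hc⟩ := count_four_pow hp h0 hM
  rw [← hc, hv.apply_count hq]

theorem apply_four_pow_sub_two_pow_add_one (hp : IsMoserDeBruijn fun n => q (n + 1)) (h0 : q 0 = 0)
    (hv : IsCharacteristicSequence 0 q v) {M : ℕ} (hM : 1 ≤ M) :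
    v (4 ^ M - 2 ^ M + 1) = 4 ^ M + 3 := by
  obtain ⟨hq, hc⟩ := count_four_pow hp h0 hM
  obtain ⟨M, rfl⟩ := Nat.exists_eq_add_of_le' hM
  have h₁ : q (4 ^ (M + 1) + 1) = 1 := hp.apply_four_pow (M + 1)
  have h₂ : q (4 ^ (M + 1) + 2) = 1 := by
    have := hp.four_mul_add_one (4 ^ M)
    rw [← pow_succ', hp.apply_four_pow M] at this
    exact this
  have h₃ : q (4 ^ (M + 1) + 3) = 0 := by
    have := hp.four_mul_add_two (4 ^ M)
    rw [← pow_succ'] at this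
    exact this
  rw [← hv.apply_count h₃]
  congr 1
  simp [Nat.count_succ, hc, hq, h₁, h₂]

theorem apply_add_one_of_mem_gap (hp : IsMoserDeBruijn fun n => q (n + 1)) (h0 : q 0 = 0)
    (hv : IsCharacteristicSequence 0 q v) {M n : ℕ} (hM : 1 ≤ M) (h₁ : 4 ^ M ≤ 2 * n)
    (h₂ : n < 4 ^ M - 2 ^ M) : v (n + 1) = v n + 1 := by
  have hlt := hv.1 h₂
  rw [apply_four_pow_sub_two_pow hp h0 hv hM] at hlt
  obtain ⟨M, rfl⟩ := Nat.exists_eq_add_of_le' hM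
  -- `n ≤ v n` puts `v n` in the upper half of the block, where `p` vanishes.
  have hle := hv.1.le_apply (x := n)
  exact hv.apply_add_one (hp.apply_eq_zero_of_le M (v n) (by omega) hlt)

end IsCharacteristicSequence

/-! ### Finite kernels and pumping. -/

/-- Modulo `N` only finitely many coefficient vectors remain. -/
theorem IsKRegular.finite_kKernel_cast {k : ℕ} {u : ℕ → ℤ} (hu : IsKRegular k u) (N : ℕ)
    [NeZero N] : (kKernel k fun n => (u n : ZMod N)).Finite := by
  obtain ⟨m, s, hs⟩ := hu
  refine (Set.finite_range fun (a : Fin m → ZMod N) (n : ℕ) => ∑ r, a r * (s r n : ZMod N)).subset ?_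
  rintro w ⟨i, j, hj, rfl⟩
  obtain ⟨a, ha⟩ := hs _ ⟨i, j, hj, rfl⟩
  refine ⟨fun r => a r, funext fun n => ?_⟩
  simp [ha n]

theorem finite_kKernel_sub_succ {M : Type*} [AddCommGroup M] {k : ℕ} {u : ℕ → M}
    (hu : (kKernel k u).Finite) : (kKernel k fun n => u (n + 1) - u n).Finite := by
  refine ((hu.union (hu.image fun w n => w (n + 1))).image2 (fun x y => x - y) hu).subset ?_
  rintro w ⟨i, j, hj, rfl⟩
  refine ⟨fun n => u (k ^ i * n + j + 1), ?_, _, ⟨i, j, hj, rfl⟩, rfl⟩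
  rcases Nat.lt_or_ge (j + 1) (k ^ i) with h | h
  · exact Or.inl ⟨i, j + 1, h, rfl⟩
  -- Here `j + 1 = k ^ i`, and the carry moves `n` to `n + 1`.
  · refine Or.inr ⟨_, ⟨i, 0, by omega, rfl⟩, funext fun n => ?_⟩
    change u _ = u _
    congr 1
    rw [mul_add]
    omega

/-- Two of the base-`k` suffixes of `a` give the same kernel element, so the digits between them
(the block `m`) can be inserted repeatedly. As `L` does not depend on `a`, a large `a` keeps a
nonzero leading part. -/
theorem exists_pumping {M : Type*} {k : ℕ} (hk : 0 < k) {c : ℕ → M}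
    (hc : (kKernel k c).Finite) : ∃ L, ∀ a, ∃ i j p m, i ≤ L ∧ 0 < p ∧ a = k ^ i * (a / k ^ i) + j ∧
      ∀ n, c (k ^ i * (k ^ p * n + m) + j) = c (k ^ i * n + j) := by
  refine ⟨hc.toFinset.card, fun a => ?_⟩
  obtain ⟨i, hi, i', hi', hne, heq⟩ := Finset.exists_ne_map_eq_of_card_lt_of_maps_to
    (s := Finset.range (hc.toFinset.card + 1)) (t := hc.toFinset) (by simp)
    (f := fun i n => c (k ^ i * n + a % k ^ i))
    (fun i _ => by simpa using ⟨i, _, Nat.mod_lt _ (pow_pos hk i), rfl⟩)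
  wlog hlt : i < i' generalizing i i'
  · exact this i' hi' i hi hne.symm heq.symm (by omega)
  obtain ⟨p, rfl⟩ := Nat.exists_eq_add_of_lt hlt
  refine ⟨i, a % k ^ i, p + 1, a / k ^ i % k ^ (p + 1), by simp at hi; omega, by omega,
    (Nat.div_add_mod a (k ^ i)).symm, fun n => ?_⟩
  refine Eq.trans ?_ (congrFun heq n).symm
  rw [show i + p + 1 = i + (p + 1) by ring, pow_add k i, Nat.mod_mul]
  congr 1
  ring

theorem exists_mul_pow_shift {M : Type*} {k : ℕ} (hk : 0 < k) {c : ℕ → M}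
    (hc : (kKernel k c).Finite) : ∃ i p, 0 < p ∧ ∀ n, c (k ^ (i + p) * n) = c (k ^ i * n) := by
  have hf (i : ℕ) : (fun n => c (k ^ i * n)) ∈ kKernel k c := ⟨i, 0, pow_pos hk i, rfl⟩
  obtain ⟨i, i', hne, heq⟩ := Set.Finite.exists_lt_map_eq_of_forall_mem hf hc
  obtain ⟨p, rfl⟩ := Nat.exists_eq_add_of_lt hne
  exact ⟨i, p + 1, by omega, fun n => (congrFun heq n).symm⟩

/-! ### Powers of `K` against powers of 4. -/

open Filter Topology in
theorem Irrational.frequently_nat_mul_sub_int_mem_Ioo {θ : ℝ} (hθ : Irrational θ) {a b : ℝ}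
    (hab : a < b) : ∃ᶠ t : ℕ in atTop, ∃ M : ℤ, (t : ℝ) * θ - M ∈ Set.Ioo a b := by
  obtain ⟨y, hy⟩ := exists_between hab
  have hd : DenseRange (· • (θ : AddCircle (1 : ℝ)) : ℤ → AddCircle (1 : ℝ)) :=
    AddCircle.denseRange_zsmul_coe_iff.2 (by simpa using hθ)
  have hm : MapClusterPt (y : AddCircle (1 : ℝ)) atTop (· • (θ : AddCircle (1 : ℝ)) : ℕ → _) :=
    ((mapClusterPt_atTop_nsmul_tfae _ _).out 0 3).2 (hd _)
  have hn : ((↑) : ℝ → AddCircle (1 : ℝ)) '' Set.Ioo a b ∈ 𝓝 (y : AddCircle (1 : ℝ)) :=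
    (QuotientAddGroup.isOpenMap_coe _ isOpen_Ioo).mem_nhds ⟨y, hy, rfl⟩
  refine (hm.frequently hn).mono ?_
  rintro t ⟨x, hx, hxt⟩
  have hxt' : ((t * θ : ℝ) : AddCircle (1 : ℝ)) = x := by
    rw [hxt, ← nsmul_eq_mul]
    rfl
  obtain ⟨M, hM⟩ := AddSubgroup.mem_zmultiples_iff.1 ((QuotientAddGroup.eq).1 hxt'.symm)
  refine ⟨M, ?_⟩
  rw [zsmul_one] at hM
  convert hx using 1
  linarith

theorem irrational_log_div_log_four {k : ℕ} (hk : 2 ≤ k) (h : ∀ r, k ≠ 2 ^ r) :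
    Irrational (Real.log k / Real.log 4) := by
  rintro ⟨x, hx⟩
  have h4 : 0 < Real.log 4 := Real.log_pos (by norm_num)
  have hk' : 0 < Real.log k := Real.log_pos (by exact_mod_cast hk)
  have hx0 : 0 < x := by
    have : 0 < (x : ℝ) := hx ▸ div_pos hk' h4
    exact_mod_cast this
  obtain ⟨n, hn⟩ := Int.eq_ofNat_of_zero_le (Rat.num_pos.2 hx0).le
  have he : (x.den : ℝ) * Real.log k = n * Real.log 4 := by
    have hd : (x.den : ℝ) ≠ 0 := by exact_mod_cast x.den_ne_zero
    rw [eq_div_iff h4.ne', Rat.cast_def, hn] at hx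
    field_simp at hx
    push_cast at hx
    linarith
  have hp : k ^ x.den = 4 ^ n := by
    have : Real.log ((k : ℝ) ^ x.den) = Real.log ((4 : ℝ) ^ n) := by
      rw [Real.log_pow, Real.log_pow, he]
    have := Real.log_injOn_pos (Set.mem_Ioi.2 (by positivity)) (Set.mem_Ioi.2 (by positivity)) this
    exact_mod_cast this
  have hdvd : k ∣ 2 ^ (2 * n) := by
    rw [pow_mul]
    norm_num
    exact hp ▸ dvd_pow_self k x.den_ne_zero
  obtain ⟨r, -, hr⟩ := (Nat.dvd_prime_pow Nat.prime_two).1 hdvd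
  exact h r hr

open Filter in
theorem frequently_mul_pow_mem_Ioo {K α u w : ℝ} (hK : 0 < K) (hα : 0 < α) (hu : 0 < u)
    (huw : u < w) (hθ : Irrational (Real.log K / Real.log 4)) :
    ∃ᶠ t : ℕ in atTop, ∃ M : ℤ, α * K ^ t ∈ Set.Ioo (u * 4 ^ M) (w * 4 ^ M) := by
  have h4 : 0 < Real.log 4 := Real.log_pos (by norm_num)
  have hw := hu.trans huw
  have hab : (Real.log u - Real.log α) / Real.log 4 < (Real.log w - Real.log α) / Real.log 4 :=
    div_lt_div_of_pos_right (sub_lt_sub_right (Real.log_lt_log hu huw) _) h4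
  refine (hθ.frequently_nat_mul_sub_int_mem_Ioo hab).mono ?_
  rintro t ⟨M, h₁, h₂⟩
  have hl : Real.log (α * K ^ t) = Real.log α + t * Real.log K := by
    rw [Real.log_mul hα.ne' (by positivity), Real.log_pow]
  have hm (z : ℝ) (hz : 0 < z) : Real.log (z * 4 ^ M) = Real.log z + M * Real.log 4 := by
    rw [Real.log_mul hz.ne' (by positivity), Real.log_zpow]
  rw [div_lt_iff₀ h4, sub_mul, mul_assoc, div_mul_cancel₀ _ h4.ne'] at h₁
  rw [lt_div_iff₀ h4, sub_mul, mul_assoc, div_mul_cancel₀ _ h4.ne'] at h₂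
  refine ⟨M, (Real.log_lt_log_iff (by positivity) (by positivity)).1 ?_,
    (Real.log_lt_log_iff (by positivity) (by positivity)).1 ?_⟩
  · rw [hl, hm u hu]; linarith
  · rw [hl, hm w hw]; linarith

open Filter in
/-- A shifted exponential sequence whose base is multiplicatively independent of `4` meets
one of the intervals `[4 ^ M / 2, 3 / 4 * 4 ^ M)` with `2 ≤ M`. -/
theorem exists_mul_pow_add_mem_Ico {K α : ℝ} (β : ℝ) (hK : 1 < K) (hα : 0 < α)
    (hθ : Irrational (Real.log K / Real.log 4)) :
    ∃ t M : ℕ, 2 ≤ M ∧ (4 : ℝ) ^ M / 2 ≤ α * K ^ t + β ∧ α * K ^ t + β < 3 / 4 * 4 ^ M := by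
  have hlim : Tendsto (fun t : ℕ => α * K ^ t) atTop atTop :=
    (tendsto_pow_atTop_atTop_of_one_lt hK).const_mul_atTop hα
  -- `(3/5, 7/10)` lies inside `[1/2, 3/4)` with room for `β`, at most 1/20 of the main term; the
  -- bound 16 forces `M > 2`.
  obtain ⟨t, ⟨M, h₁, h₂⟩, h₃, h₄⟩ := ((frequently_mul_pow_mem_Ioo (by linarith) hα
    (by norm_num : (0 : ℝ) < 3 / 5) (by norm_num : (3 / 5 : ℝ) < 7 / 10) hθ).and_eventually
      ((hlim.eventually_ge_atTop 16).and (hlim.eventually_ge_atTop (20 * |β|)))).exists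
  have hM : 2 < M := by
    by_contra! h
    have : (4 : ℝ) ^ M ≤ 4 ^ (2 : ℤ) := zpow_le_zpow_right₀ (by norm_num) h
    norm_num at this
    linarith
  lift M to ℕ using by omega
  rw [zpow_natCast] at h₁ h₂
  refine ⟨t, M, by omega, ?_, ?_⟩
  · linarith [neg_abs_le β]
  · linarith [le_abs_self β]

theorem four_pow_eq (n : ℕ) : 4 ^ n = 2 ^ n * 2 ^ n := by
  rw [← mul_pow, show 2 * 2 = 4 from rfl]

/-! ### Infinite kernels from gaps. -/

section Gap

variable {M : Type*} {c : ℕ → M} {x : M}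

theorem infinite_kKernel_two_pow {r : ℕ} (hr : r ≠ 0)
    (hA : ∀ M, 1 ≤ M → c (4 ^ M - 2 ^ M) ≠ x)
    (hgap : ∀ M n, 1 ≤ M → 4 ^ M ≤ 2 * n → n < 4 ^ M - 2 ^ M → c n = x) :
    (kKernel (2 ^ r) c).Infinite := by
  intro hc
  obtain ⟨i, p, hp, h⟩ := exists_mul_pow_shift (by positivity) hc
  have hshift (N n : ℕ) (hN : i ≤ N) : c ((2 ^ r) ^ (N + p) * n) = c ((2 ^ r) ^ N * n) := by
    obtain ⟨d, rfl⟩ := Nat.exists_eq_add_of_le hN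
    have := h ((2 ^ r) ^ d * n)
    rwa [← mul_assoc, ← mul_assoc, ← pow_add, ← pow_add, add_right_comm] at this
  obtain ⟨N, hN⟩ : ∃ N, N = i + 1 := ⟨_, rfl⟩
  have h4 (n : ℕ) : 4 ^ (r * n) = (2 ^ r) ^ n * (2 ^ r) ^ n := by
    rw [four_pow_eq, pow_mul]
  have hK : 2 ≤ 2 ^ r := Nat.le_self_pow hr 2
  have hKN : 2 ≤ (2 ^ r) ^ N := hK.trans (Nat.le_self_pow (by omega) _)
  have hKp : 2 ≤ (2 ^ r) ^ p := hK.trans (Nat.le_self_pow (by omega) _)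
  refine hA (r * N) (Nat.mul_pos (by omega) (by omega)) ?_
  have he : 4 ^ (r * N) - 2 ^ (r * N) = (2 ^ r) ^ N * ((2 ^ r) ^ N - 1) := by
    rw [h4, pow_mul 2 r N, Nat.mul_sub, mul_one]
  -- Shifting twice multiplies by the square `(2 ^ r) ^ (2 * p)`, so the point lands just below `4 ^
  -- (r * (N + p))`.
  rw [he, ← hshift N _ (by omega), ← hshift (N + p) _ (by omega)]
  refine hgap (r * (N + p)) _ (Nat.mul_pos (by omega) (by omega)) ?_ ?_
  · rw [h4]
    simp only [pow_add]
    generalize (2 ^ r) ^ N = a at *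
    generalize (2 ^ r) ^ p = b at *
    calc a * b * (a * b) = a * b * b * a := by ring
      _ ≤ a * b * b * (2 * (a - 1)) := Nat.mul_le_mul_left _ (by omega)
      _ = 2 * (a * b * b * (a - 1)) := by ring
  · rw [h4, pow_mul 2 r (N + p)]
    simp only [pow_add]
    generalize (2 ^ r) ^ N = a at *
    generalize (2 ^ r) ^ p = b at *
    obtain ⟨a, rfl⟩ := Nat.exists_eq_add_of_le' (show 1 ≤ a by omega)
    rw [Nat.add_sub_cancel, ← Nat.mul_sub_one, mul_assoc]
    refine Nat.mul_lt_mul_of_pos_left ?_ (Nat.mul_pos (by omega) (by omega))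
    have : b * a + 1 < (a + 1) * b := by linarith
    omega

theorem infinite_kKernel_of_ne_two_pow {k : ℕ} (hk : 2 ≤ k) (hk' : ∀ r, k ≠ 2 ^ r)
    (hA : ∀ M, 1 ≤ M → c (4 ^ M - 2 ^ M) ≠ x)
    (hgap : ∀ M n, 1 ≤ M → 4 ^ M ≤ 2 * n → n < 4 ^ M - 2 ^ M → c n = x) :
    (kKernel k c).Infinite := by
  intro hc
  obtain ⟨L, hL⟩ := exists_pumping (by omega) hc
  obtain ⟨M, hM, hkM⟩ : ∃ M, 1 ≤ M ∧ k ^ L ≤ 4 ^ M - 2 ^ M := by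
    refine ⟨k ^ L + 1, by omega, ?_⟩
    have h₁ : k ^ L < 2 ^ k ^ L := Nat.lt_two_pow_self
    rw [four_pow_eq, ← Nat.mul_sub_one, pow_succ]
    generalize 2 ^ k ^ L = y at *
    have : 1 ≤ y * 2 - 1 := by omega
    nlinarith
  obtain ⟨i, j, p, m, hi, hp, ha, h⟩ := hL (4 ^ M - 2 ^ M)
  have hki : 0 < k ^ i := pow_pos (by omega) i
  set n₀ := (4 ^ M - 2 ^ M) / k ^ i with hn₀
  have hn₀' : 1 ≤ n₀ := Nat.div_pos ((Nat.pow_le_pow_right (by omega) hi).trans hkM) hki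
  have hcn : c (k ^ i * n₀ + j) ≠ x := ha ▸ hA M hM
  set T : ℕ → ℕ := fun n => k ^ p * n + m
  have hcT (t : ℕ) : c (k ^ i * T^[t] n₀ + j) ≠ x := by
    induction t with
    | zero => exact hcn
    | succ t ih =>
      rw [Function.iterate_succ_apply']
      simpa only [T, h] using ih
  have hK : (1 : ℝ) < (k : ℝ) ^ p := one_lt_pow₀ (by exact_mod_cast hk) hp.ne'
  have hK' : (k : ℝ) ^ p - 1 ≠ 0 := (sub_pos.2 hK).ne'
  -- `-s` is the fixed point of `T`, so the orbit is exactly geometric after translation by `s`.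
  set s : ℝ := m / ((k : ℝ) ^ p - 1) with hs
  have hs0 : 0 ≤ s := div_nonneg (by positivity) (sub_pos.2 hK).le
  have hT (t : ℕ) : ((T^[t] n₀ : ℕ) : ℝ) + s = (n₀ + s) * ((k : ℝ) ^ p) ^ t := by
    induction t with
    | zero => simp
    | succ t ih =>
      rw [Function.iterate_succ_apply', pow_succ, ← mul_assoc, ← ih]
      simp only [T, hs]
      push_cast
      field_simp
      ring
  have hθ : Irrational (Real.log ((k : ℝ) ^ p) / Real.log 4) := by
    rw [Real.log_pow, mul_div_assoc]
    exact (irrational_log_div_log_four hk hk').natCast_mul hp.ne'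
  have hn₀r : (1 : ℝ) ≤ n₀ := by exact_mod_cast hn₀'
  obtain ⟨t, M', hM', h₁, h₂⟩ := exists_mul_pow_add_mem_Ico (α := k ^ i * (n₀ + s)) (j - k ^ i * s)
    hK (mul_pos (by exact_mod_cast hki) (by linarith)) hθ
  have he : (k : ℝ) ^ i * (n₀ + s) * ((k : ℝ) ^ p) ^ t + (j - k ^ i * s)
      = ((k ^ i * T^[t] n₀ + j : ℕ) : ℝ) := by
    rw [mul_assoc, ← hT]
    push_cast
    ring
  rw [he] at h₁ h₂
  refine hcT t (hgap M' _ (by omega) ?_ ?_)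
  · rw [div_le_iff₀ two_pos, mul_comm] at h₁
    exact_mod_cast h₁
  · have h₃ : 4 * (k ^ i * T^[t] n₀ + j) < 3 * 4 ^ M' := by
      have : (4 : ℝ) * ((k ^ i * T^[t] n₀ + j : ℕ) : ℝ) < 3 * 4 ^ M' := by linarith
      exact_mod_cast this
    have h₄ : 4 * 2 ^ M' ≤ 4 ^ M' := by
      rw [four_pow_eq]
      exact Nat.mul_le_mul_right _ (Nat.pow_le_pow_right (n := 2) two_pos hM')
    omega

end Gap

/-! ### Conclusion. -/

theorem mainTheorem4 (q : ℕ → ZMod 2) (hq : IsFormalInverse baumSweetShift q)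
    (v : ℕ → ℕ) (hv : IsCharacteristicSequence 0 q v) (k : ℕ) (hk : 2 ≤ k) :
    ¬ IsKRegular k (fun n => (v n : ℤ)) := by
  intro h
  -- Modulo 3 the jumps 3 and 1 stay distinct; modulo 2 they would not.
  have hfin := finite_kKernel_sub_succ (h.finite_kKernel_cast 3)
  have hp := hq.isMoserDeBruijn
  have h0 : q 0 = 0 := hq.2.1
  set c : ℕ → ZMod 3 := fun n => (((v (n + 1) : ℕ) : ℤ) : ZMod 3) - ((v n : ℤ) : ZMod 3) with hc
  have hA (M : ℕ) (hM : 1 ≤ M) : c (4 ^ M - 2 ^ M) ≠ 1 := by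
    simp only [hc, hv.apply_four_pow_sub_two_pow hp h0 hM,
      hv.apply_four_pow_sub_two_pow_add_one hp h0 hM]
    push_cast
    rw [add_sub_cancel_left]
    decide
  have hgap (M n : ℕ) (hM : 1 ≤ M) (h₁ : 4 ^ M ≤ 2 * n) (h₂ : n < 4 ^ M - 2 ^ M) : c n = 1 := by
    simp [hc, hv.apply_add_one_of_mem_gap hp h0 hM h₁ h₂]
  by_cases hk' : ∃ r, k = 2 ^ r
  · obtain ⟨r, rfl⟩ := hk'
    refine infinite_kKernel_two_pow ?_ hA hgap hfin
    rintro rfl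
    simp at hk
  · push Not at hk'
    exact infinite_kKernel_of_ne_two_pow hk hk' hA hgap hfin
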